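/- Let $S\subset\mathbb{C}\mathbb{P}^3$ be a quartic surface of Noether's type $S^{(2)}_4$: in suitable homogeneous coordinates, with the elliptic double point of $S$ at $[1:0:0:0]$, the surface $S$ is defined by $$x_1^2x_0^2+\bigl(x_1x_3(2x_3+B_1)+A_3\bigr)x_0+x_3^4+B_1x_3^3+B_2x_3^2+B_3x_3+B_4=0,$$ where $A_3$ is a form of degree $3$ and $B_d$ is a form of degree $d$ in $\mathbb{C}[x_1,x_2]$, and $x_1$ does not divide $A_3$ (that is, this double point is not a tacnode). Then $S$ is not a symmetroid: no nonzero scalar multiple of its defining polynomial is the determinant of a matrix $M_0x_0+M_1x_1+M_2x_2+M_3x_3$, where $M_0,M_1,M_2,M_3$ are symmetric matrices of the same size with entries in $\mathbb{C}$. In particular, no rational quartic surface of type $S^{(2)}_4$ is a symmetroid. -/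

import Mathlib

open MvPolynomial

/-! A hypersurface in complex projective `n`-space is given by its defining polynomial, a form in
`X 0, …, X n` that is determined up to a nonzero scalar. -/

/-- The matrix `A(x) = A₀ x₀ + ⋯ + Aₙ xₙ` of linear forms. -/
noncomputable def linearMatrix {n d : ℕ} (A : Fin (n + 1) → Matrix (Fin d) (Fin d) ℂ) :
    Matrix (Fin d) (Fin d) (MvPolynomial (Fin (n + 1)) ℂ) :=
  ∑ i, (X i : MvPolynomial (Fin (n + 1)) ℂ) • (A i).map C

/-- The hypersurface `V(F)` is a symmetroid: up to a nonzero scalar, its defining polynomial `F`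
is the determinant of a symmetric matrix of linear forms. The size `d` is the degree. -/
def IsSymmetroid {n : ℕ} (F : MvPolynomial (Fin (n + 1)) ℂ) : Prop :=
  ∃ (d : ℕ) (A : Fin (n + 1) → Matrix (Fin d) (Fin d) ℂ),
    (∀ i, (A i).IsSymm) ∧ ∃ c : ℂ, c ≠ 0 ∧ C c * F = (linearMatrix A).det

/-- The polynomial `F(g x)`: the linear change of coordinates `xᵢ ↦ ∑ⱼ gᵢⱼ xⱼ`. -/
noncomputable def changeCoords {n : ℕ} (g : GL (Fin (n + 1)) ℂ)
    (F : MvPolynomial (Fin (n + 1)) ℂ) : MvPolynomial (Fin (n + 1)) ℂ :=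
  aeval (fun i => ∑ j, C ((g : Matrix (Fin (n + 1)) (Fin (n + 1)) ℂ) i j) * X j) F

/-- A polynomial in two variables, read as a polynomial in `x₁, x₂` inside `ℂ[x₀, x₁, x₂, x₃]`. -/
noncomputable def inX1X2 (P : MvPolynomial (Fin 2) ℂ) : MvPolynomial (Fin 4) ℂ :=
  rename ![1, 2] P

/-- Noether's quartic polynomial
`x₁² x₀² + (x₁ x₃ (2 x₃ + B₁) + A₃) x₀ + x₃⁴ + B₁ x₃³ + B₂ x₃² + B₃ x₃ + B₄`
with `A₃, B₁, B₂, B₃, B₄` in `ℂ[x₁, x₂]`. -/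
noncomputable def noetherQuartic2 (A₃ B₁ B₂ B₃ B₄ : MvPolynomial (Fin 2) ℂ) :
    MvPolynomial (Fin 4) ℂ :=
  X 1 ^ 2 * X 0 ^ 2 + (X 1 * X 3 * (2 * X 3 + inX1X2 B₁) + inX1X2 A₃) * X 0
    + X 3 ^ 4 + inX1X2 B₁ * X 3 ^ 3 + inX1X2 B₂ * X 3 ^ 2 + inX1X2 B₃ * X 3 + inX1X2 B₄

/-- The quartic surface `V(F)` in projective 3-space is of Noether's second type: in suitable
projective coordinates, with the elliptic double point at `[1 : 0 : 0 : 0]`, its equation is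
Noether's quartic, where `A₃` and `B_d` are forms of degree `3` and `d` in `x₁, x₂`.
The condition that `x₁` (variable `X 0` of `ℂ[x₁, x₂]`) does not divide `A₃` says that the equation
is not of the form `x₁² x₀² + x₁ F₂ x₀ + F₄` of the first type, i.e. that the elliptic double point
is not a tacnode. -/
def IsNoetherType2 (F : MvPolynomial (Fin 4) ℂ) : Prop :=
  ∃ (g : GL (Fin 4) ℂ) (c : ℂ) (A₃ B₁ B₂ B₃ B₄ : MvPolynomial (Fin 2) ℂ),
    c ≠ 0 ∧ A₃.IsHomogeneous 3 ∧ B₁.IsHomogeneous 1 ∧ B₂.IsHomogeneous 2 ∧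
    B₃.IsHomogeneous 3 ∧ B₄.IsHomogeneous 4 ∧ ¬ (X 0 ∣ A₃) ∧
    changeCoords g F = C c * noetherQuartic2 A₃ B₁ B₂ B₃ B₄

/-! ### Pencils of symmetric matrices through a diagonal matrix -/

section Pencil

open Matrix

variable {d : Fin 4 → ℂ} {B : Matrix (Fin 4) (Fin 4) ℂ}

/-! Suppose a multiple of the quartic is `det (∑ xᵢ Aᵢ)`; the size is then four. On the line `x₂ =
x₃ = 0` the determinant has degree two in `x₀`, so `A₀` has rank at least two. On the plane `x₁ = 0`
it is a nonzero multiple of `a x₂³ x₀ + x₃⁴ + ⋯`, affine in `x₀`, with `a = A₃(0, 1) ≠ 0` because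
the point is not a tacnode. This section forces rank at most one.

To see this, diagonalise `A₀` by congruence and compare powers of `x₀`. Rank four gives an `x₀⁴`
term. In rank three, the row of the net at the kernel vector spans a totally isotropic space of a
nondegenerate ternary form; such a space is at most a line, so some member with `x₂ ≠ 0` makes the
whole pencil singular, against `a ≠ 0` (`not_isMonoidNet_of_rank_three`). In rank two, the net
restricted to `ker A₀` is a singular pencil with a common kernel vector; then `a x₂³` factors as a
linear form times a quadratic one, which makes `A₃` singular, against the `x₃⁴` term
(`not_isMonoidNet_of_rank_two`). -/

theorem det_diagonal_pencil_rank_le_one (h0 : d 0 = 0) (h1 : d 1 = 0) (h2 : d 2 = 0) {c α β : ℂ}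
    (h : ∀ x : ℂ, (x • diagonal d + B).det = c * (x ^ 2 + α * x + β)) : c = 0 := by
  simp [det_succ_row_zero, Fin.sum_univ_succ, diagonal_apply, Fin.succAbove, h0, h1, h2] at h
  have e0 := h 0
  have e1 := h 1
  have e2 := h (-1)
  -- The left side is affine in `x`, so its second difference vanishes.
  linear_combination (-1 / 2) * (e1 + e2 - 2 * e0)

/-- The product is the coefficient of `x³`, isolated by a third difference. -/
theorem det_diagonal_pencil_cubic_coeff (hB : B.IsSymm) (h0 : d 0 = 0) {p q : ℂ}
    (h : ∀ x : ℂ, (x • diagonal d + B).det = p * x + q) : B 0 0 * (d 1 * d 2 * d 3) = 0 := by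
  have e := hB.apply
  simp [det_succ_row_zero, Fin.sum_univ_succ, diagonal_apply, Fin.succAbove, h0, e 0 1, e 0 2,
    e 0 3, e 1 2, e 1 3, e 2 3] at h
  have e0 := h 0
  have e1 := h 1
  have e2 := h (-1)
  have e3 := h 2
  linear_combination (1 / 6) * (e3 - 3 * e1 + 3 * e0 - e2)

theorem det_diagonal_pencil_quadratic_coeff (hB : B.IsSymm) (h0 : d 0 = 0) (h00 : B 0 0 = 0)
    {p q : ℂ} (h : ∀ x : ℂ, (x • diagonal d + B).det = p * x + q) :
    d 2 * d 3 * B 0 1 ^ 2 + d 1 * d 3 * B 0 2 ^ 2 + d 1 * d 2 * B 0 3 ^ 2 = 0 := by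
  have e := hB.apply
  simp [det_succ_row_zero, Fin.sum_univ_succ, diagonal_apply, Fin.succAbove, h0, h00, e 0 1, e 0 2,
    e 0 3, e 1 2, e 1 3, e 2 3] at h
  have e0 := h 0
  have e1 := h 1
  have e2 := h (-1)
  linear_combination (-1 / 2) * (e1 + e2 - 2 * e0)

theorem det_diagonal_pencil_quadratic_coeff_of_rank_two (hB : B.IsSymm) (h0 : d 0 = 0)
    (h1 : d 1 = 0) {p q : ℂ} (h : ∀ x : ℂ, (x • diagonal d + B).det = p * x + q) :
    (B 0 0 * B 1 1 - B 0 1 ^ 2) * (d 2 * d 3) = 0 := by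
  have e := hB.apply
  simp [det_succ_row_zero, Fin.sum_univ_succ, diagonal_apply, Fin.succAbove, h0, h1, e 0 1, e 0 2,
    e 0 3, e 1 2, e 1 3, e 2 3] at h
  have e0 := h 0
  have e1 := h 1
  have e2 := h (-1)
  linear_combination (1 / 2) * (e1 + e2 - 2 * e0)

/-- The zeros in column 1 make the two principal minors that contribute to the `x` term share the
factor `B 0 0`. -/
theorem det_diagonal_pencil_linear_coeff (hB : B.IsSymm) (h0 : d 0 = 0) (h1 : d 1 = 0)
    (h01 : B 0 1 = 0) (h11 : B 1 1 = 0) {p q : ℂ}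
    (h : ∀ x : ℂ, (x • diagonal d + B).det = p * x + q) :
    p = -(B 0 0 * (d 3 * B 1 2 ^ 2 + d 2 * B 1 3 ^ 2)) := by
  have e := hB.apply
  simp [det_succ_row_zero, Fin.sum_univ_succ, diagonal_apply, Fin.succAbove, h0, h1, h01, h11,
    e 0 1, e 0 2, e 0 3, e 1 2, e 1 3, e 2 3] at h
  have e0 := h 0
  have e1 := h 1
  linear_combination e0 - e1

end Pencil

/-! ### Binary forms and isotropic vectors -/

theorem binary_quadratic_eq_zero {p q r : ℂ}
    (h : ∀ y z : ℂ, p * y ^ 2 + q * y * z + r * z ^ 2 = 0) : p = 0 ∧ q = 0 ∧ r = 0 := by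
  have h₁ := h 1 0
  have h₂ := h 0 1
  have h₃ := h 1 1
  exact ⟨by linear_combination h₁, by linear_combination h₃ - h₁ - h₂, by linear_combination h₂⟩

theorem binary_cubic_eq_zero {p q r s : ℂ}
    (h : ∀ y z : ℂ, p * y ^ 3 + q * y ^ 2 * z + r * y * z ^ 2 + s * z ^ 3 = 0) :
    p = 0 ∧ q = 0 ∧ r = 0 ∧ s = 0 := by
  have h₁ := h 1 0
  have h₂ := h 0 1
  have h₃ := h 1 1
  have h₄ := h 1 (-1)
  exact ⟨by linear_combination h₁, by linear_combination (h₃ - h₄ - 2 * h₂) / 2,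
    by linear_combination (h₃ + h₄ - 2 * h₁) / 2, by linear_combination h₂⟩

/-- Two orthogonal isotropic vectors of a nondegenerate ternary quadratic form are proportional. -/
theorem exists_smul_of_isotropic {w₁ w₂ w₃ s₁ s₂ s₃ t₁ t₂ t₃ : ℂ}
    (hw₁ : w₁ ≠ 0) (hw₂ : w₂ ≠ 0) (hw₃ : w₃ ≠ 0)
    (hss : w₁ * s₁ ^ 2 + w₂ * s₂ ^ 2 + w₃ * s₃ ^ 2 = 0)
    (hst : w₁ * s₁ * t₁ + w₂ * s₂ * t₂ + w₃ * s₃ * t₃ = 0)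
    (htt : w₁ * t₁ ^ 2 + w₂ * t₂ ^ 2 + w₃ * t₃ ^ 2 = 0) (ht : t₁ ≠ 0 ∨ t₂ ≠ 0 ∨ t₃ ≠ 0) :
    ∃ k, s₁ = k * t₁ ∧ s₂ = k * t₂ ∧ s₃ = k * t₃ := by
  have key : ∀ {w₁ w₂ w₃ s₁ s₂ s₃ t₁ t₂ t₃ : ℂ}, w₁ ≠ 0 → w₂ ≠ 0 →
      w₁ * s₁ ^ 2 + w₂ * s₂ ^ 2 + w₃ * s₃ ^ 2 = 0 →
      w₁ * s₁ * t₁ + w₂ * s₂ * t₂ + w₃ * s₃ * t₃ = 0 →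
      w₁ * t₁ ^ 2 + w₂ * t₂ ^ 2 + w₃ * t₃ ^ 2 = 0 → s₁ * t₂ - s₂ * t₁ = 0 := by
    intro w₁ w₂ w₃ s₁ s₂ s₃ t₁ t₂ t₃ hw₁ hw₂ hss hst htt
    -- Lagrange's identity: this is the Gram determinant of the form truncated to two coordinates,
    -- whose entries are `-w₃ s₃²`, `-w₃ s₃ t₃`, `-w₃ t₃²`.
    have h : w₁ * w₂ * (s₁ * t₂ - s₂ * t₁) ^ 2 = 0 := by
      by_cases h₃ : s₃ = 0 ∧ t₃ = 0
      · obtain ⟨h, h'⟩ := h₃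
        simp only [h, h'] at hss hst htt
        grind
      · grind
    have := (mul_eq_zero.mp h).resolve_left (mul_ne_zero hw₁ hw₂)
    exact pow_eq_zero_iff two_ne_zero |>.mp this
  have h₁₂ := key hw₁ hw₂ hss hst htt
  have h₁₃ := key (w₁ := w₁) (w₂ := w₃) (w₃ := w₂) (s₁ := s₁) (s₂ := s₃) (s₃ := s₂)
    (t₁ := t₁) (t₂ := t₃) (t₃ := t₂) hw₁ hw₃ (by linear_combination hss)
    (by linear_combination hst) (by linear_combination htt)
  have h₂₃ := key (w₁ := w₂) (w₂ := w₃) (w₃ := w₁) (s₁ := s₂) (s₂ := s₃) (s₃ := s₁)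
    (t₁ := t₂) (t₂ := t₃) (t₃ := t₁) hw₂ hw₃ (by linear_combination hss)
    (by linear_combination hst) (by linear_combination htt)
  rcases ht with ht | ht | ht
  · refine ⟨s₁ / t₁, ?_, ?_, ?_⟩ <;> field_simp <;> grind
  · refine ⟨s₂ / t₂, ?_, ?_, ?_⟩ <;> field_simp <;> grind
  · refine ⟨s₃ / t₃, ?_, ?_, ?_⟩ <;> field_simp <;> grind

/-- A singular pencil of binary quadratic forms has a common kernel vector. -/
theorem exists_common_kernel_of_singular_pencil {s₀ s₁ s₂ t₀ t₁ t₂ : ℂ}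
    (hs : s₀ * s₂ = s₁ ^ 2) (hst : s₀ * t₂ + s₂ * t₀ = 2 * s₁ * t₁) (ht : t₀ * t₂ = t₁ ^ 2) :
    ∃ e₀ e₁ : ℂ, (e₀ ≠ 0 ∨ e₁ ≠ 0) ∧ s₀ * e₀ + s₁ * e₁ = 0 ∧ s₁ * e₀ + s₂ * e₁ = 0 ∧
      t₀ * e₀ + t₁ * e₁ = 0 ∧ t₁ * e₀ + t₂ * e₁ = 0 := by
  have h₀ : s₀ * t₁ = s₁ * t₀ := by
    have : (s₀ * t₁ - s₁ * t₀) ^ 2 = 0 := by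
      linear_combination s₀ * t₀ * hst - t₀ ^ 2 * hs - s₀ ^ 2 * ht
    exact sub_eq_zero.mp (pow_eq_zero_iff two_ne_zero |>.mp this)
  have h₂ : s₂ * t₁ = s₁ * t₂ := by
    have : (s₂ * t₁ - s₁ * t₂) ^ 2 = 0 := by
      linear_combination s₂ * t₂ * hst - t₂ ^ 2 * hs - s₂ ^ 2 * ht
    exact sub_eq_zero.mp (pow_eq_zero_iff two_ne_zero |>.mp this)
  have h₃ : s₀ * t₂ = s₁ * t₁ := by grind
  have h₄ : s₂ * t₀ = s₁ * t₁ := by linear_combination hst - h₃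
  by_cases a : t₀ = 0
  · by_cases b : t₂ = 0
    · have c : t₁ = 0 := by simpa [a] using ht.symm
      by_cases a' : s₀ = 0
      · by_cases b' : s₂ = 0
        · have c' : s₁ = 0 := by simpa [a'] using hs.symm
          exact ⟨1, 0, by simp [a, b, c, a', b', c']⟩
        · exact ⟨s₂, -s₁, Or.inl b', by grind⟩
      · exact ⟨-s₁, s₀, Or.inr a', by grind⟩
    · exact ⟨t₂, -t₁, Or.inl b, by grind⟩
  · exact ⟨-t₁, t₀, Or.inr a, by grind⟩

/-! ### The determinant of a net of symmetric matrices -/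

section Net

open Matrix

/-- `A`, `S`, `T` are symmetric and `det (x A + y S + z T) = a y³ x + G(y, z)`, where `a` and
`G(0, 1)` are nonzero. -/
structure IsMonoidNet (A S T : Matrix (Fin 4) (Fin 4) ℂ) : Prop where
  symm₁ : S.IsSymm
  symm₂ : T.IsSymm
  exists_det : ∃ (a : ℂ) (G : ℂ → ℂ → ℂ), a ≠ 0 ∧ G 0 1 ≠ 0 ∧
    ∀ x y z : ℂ, (x • A + (y • S + z • T)).det = a * y ^ 3 * x + G y z

theorem Matrix.IsSymm.congruence {n : Type*} [Fintype n] {A : Matrix n n ℂ} (hA : A.IsSymm)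
    (P : Matrix n n ℂ) : (Pᵀ * A * P).IsSymm := by
  simp only [IsSymm, transpose_mul, transpose_transpose, hA.eq, Matrix.mul_assoc]

theorem IsMonoidNet.congruence {A S T P : Matrix (Fin 4) (Fin 4) ℂ} (h : IsMonoidNet A S T)
    (hP : P.det ≠ 0) : IsMonoidNet (Pᵀ * A * P) (Pᵀ * S * P) (Pᵀ * T * P) := by
  obtain ⟨a, G, ha, hG, hdet⟩ := h.exists_det
  refine ⟨h.symm₁.congruence P, h.symm₂.congruence P, a * P.det ^ 2, fun y z => G y z * P.det ^ 2,
    mul_ne_zero ha (pow_ne_zero 2 hP), mul_ne_zero hG (pow_ne_zero 2 hP), fun x y z => ?_⟩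
  have : x • (Pᵀ * A * P) + (y • (Pᵀ * S * P) + z • (Pᵀ * T * P)) =
      Pᵀ * (x • A + (y • S + z • T)) * P := by
    simp only [Matrix.mul_add, Matrix.add_mul, Matrix.mul_smul, Matrix.smul_mul]
  rw [this, det_mul, det_mul, det_transpose, hdet]
  ring

theorem IsMonoidNet.det_ne_zero {A S T : Matrix (Fin 4) (Fin 4) ℂ} (h : IsMonoidNet A S T) :
    T.det ≠ 0 := by
  obtain ⟨a, G, -, hG, hdet⟩ := h.exists_det
  have := hdet 0 0 1
  simp only [zero_smul, one_smul, zero_add, mul_zero] at this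
  rwa [this]

theorem IsMonoidNet.isSymm {A S T : Matrix (Fin 4) (Fin 4) ℂ} (h : IsMonoidNet A S T) (y z : ℂ) :
    (y • S + z • T).IsSymm :=
  (h.symm₁.smul y).add (h.symm₂.smul z)

theorem IsMonoidNet.prod_eq_zero {S T : Matrix (Fin 4) (Fin 4) ℂ} {d : Fin 4 → ℂ}
    (h : IsMonoidNet (diagonal d) S T) : d 0 * d 1 * d 2 * d 3 = 0 := by
  obtain ⟨a, G, -, -, hdet⟩ := h.exists_det
  have e := fun x => hdet x 0 0
  simp only [zero_smul, add_zero, det_smul, det_diagonal, Fin.prod_univ_four, Fintype.card_fin]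
    at e
  have e0 := e 0
  have e1 := e 1
  have e2 := e (-1)
  linear_combination (e1 + e2 - 2 * e0) / 2

theorem not_isMonoidNet_of_rank_three {S T : Matrix (Fin 4) (Fin 4) ℂ} {d : Fin 4 → ℂ}
    (h0 : d 0 = 0) (h1 : d 1 ≠ 0) (h2 : d 2 ≠ 0) (h3 : d 3 ≠ 0) :
    ¬ IsMonoidNet (diagonal d) S T := by
  intro h
  obtain ⟨a, G, ha, -, hdet⟩ := h.exists_det
  have hcub : ∀ y z, (y • S + z • T) 0 0 = 0 := fun y z =>
    (mul_eq_zero.mp (det_diagonal_pencil_cubic_coeff (h.isSymm y z) h0 fun x => hdet x y z)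
      ).resolve_right (by simp [h1, h2, h3])
  have hquad := fun y z =>
    det_diagonal_pencil_quadratic_coeff (h.isSymm y z) h0 (hcub y z) fun x => hdet x y z
  have hS : S 0 0 = 0 := by simpa using hcub 1 0
  have hT : T 0 0 = 0 := by simpa using hcub 0 1
  simp only [Matrix.add_apply, Matrix.smul_apply, smul_eq_mul] at hquad
  obtain ⟨hss, hst, htt⟩ := binary_quadratic_eq_zero
    (p := d 2 * d 3 * S 0 1 ^ 2 + d 1 * d 3 * S 0 2 ^ 2 + d 1 * d 2 * S 0 3 ^ 2)
    (q := 2 * (d 2 * d 3 * S 0 1 * T 0 1 + d 1 * d 3 * S 0 2 * T 0 2 + d 1 * d 2 * S 0 3 * T 0 3))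
    (r := d 2 * d 3 * T 0 1 ^ 2 + d 1 * d 3 * T 0 2 ^ 2 + d 1 * d 2 * T 0 3 ^ 2)
    fun y z => by linear_combination hquad y z
  have hne : T 0 1 ≠ 0 ∨ T 0 2 ≠ 0 ∨ T 0 3 ≠ 0 := by
    by_contra! hc
    refine h.det_ne_zero (det_eq_zero_of_row_eq_zero 0 fun j => ?_)
    fin_cases j
    exacts [hT, hc.1, hc.2.1, hc.2.2]
  obtain ⟨k, hk₁, hk₂, hk₃⟩ := exists_smul_of_isotropic (mul_ne_zero h2 h3) (mul_ne_zero h1 h3)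
    (mul_ne_zero h1 h2) hss (by linear_combination hst / 2) htt hne
  -- Row 0 of `S - k T` vanishes, and so does row 0 of the diagonal matrix; at `y = 1` the `x`
  -- coefficient is `a`.
  have hzero : ∀ x : ℂ, (x • diagonal d + ((1 : ℂ) • S + (-k) • T)).det = 0 := fun x => by
    refine det_eq_zero_of_row_eq_zero 0 fun j => ?_
    fin_cases j <;> simp [h0, hS, hT, hk₁, hk₂, hk₃]
  apply ha
  have e0 := (hdet 0 1 (-k)).symm.trans (hzero 0)
  have e1 := (hdet 1 1 (-k)).symm.trans (hzero 1)
  linear_combination e1 - e0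

/-- A linear form times a binary quadratic form `d₃ (s y + t z)₁² + d₂ (s y + t z)₂²` is a nonzero
multiple of `y³` only if `t = 0`. -/
theorem eq_zero_of_mul_eq_cube {a m n d₂ d₃ s₁ s₂ t₁ t₂ : ℂ} (ha : a ≠ 0) (hd₂ : d₂ ≠ 0)
    (hd₃ : d₃ ≠ 0) (h : ∀ y z : ℂ, a * y ^ 3 = -((y * m + z * n) *
      (d₃ * (y * s₁ + z * t₁) ^ 2 + d₂ * (y * s₂ + z * t₂) ^ 2))) : t₁ = 0 ∧ t₂ = 0 := by
  obtain ⟨e₁, e₂, e₃, e₄⟩ := binary_cubic_eq_zero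
    (p := m * (d₃ * s₁ ^ 2 + d₂ * s₂ ^ 2) + a)
    (q := n * (d₃ * s₁ ^ 2 + d₂ * s₂ ^ 2) + 2 * m * (d₃ * s₁ * t₁ + d₂ * s₂ * t₂))
    (r := m * (d₃ * t₁ ^ 2 + d₂ * t₂ ^ 2) + 2 * n * (d₃ * s₁ * t₁ + d₂ * s₂ * t₂))
    (s := n * (d₃ * t₁ ^ 2 + d₂ * t₂ ^ 2))
    fun y z => by linear_combination h y z
  have hm : m ≠ 0 := by rintro rfl; exact ha (by linear_combination e₁)
  have hQ : d₃ * s₁ ^ 2 + d₂ * s₂ ^ 2 ≠ 0 := fun hQ => ha (by rw [hQ] at e₁; simpa using e₁)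
  have hn : n = 0 := by
    by_contra hn
    have q₁ : d₃ * t₁ ^ 2 + d₂ * t₂ ^ 2 = 0 := by simpa [hn] using e₄
    have q₂ : d₃ * s₁ * t₁ + d₂ * s₂ * t₂ = 0 := by simpa [hn, q₁] using e₃
    simp [q₂, hn, hQ] at e₂
  have q₁ : d₃ * t₁ ^ 2 + d₂ * t₂ ^ 2 = 0 := by simpa [hn, hm] using e₃
  have q₂ : d₃ * s₁ * t₁ + d₂ * s₂ * t₂ = 0 := by simpa [hn, hm] using e₂
  -- Lagrange's identity again: `t` is both orthogonal and parallel to the anisotropic vector `s`,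
  -- hence zero.
  have q₃ : s₁ * t₂ - s₂ * t₁ = 0 := by
    have : d₂ * d₃ * (s₁ * t₂ - s₂ * t₁) ^ 2 = 0 := by
      linear_combination (d₃ * s₁ ^ 2 + d₂ * s₂ ^ 2) * q₁ -
        (d₃ * s₁ * t₁ + d₂ * s₂ * t₂) * q₂
    simpa [hd₂, hd₃] using this
  constructor
  · refine (mul_eq_zero.mp (?_ : (d₃ * s₁ ^ 2 + d₂ * s₂ ^ 2) * t₁ = 0)).resolve_left hQ
    linear_combination s₁ * q₂ - d₂ * s₂ * q₃
  · refine (mul_eq_zero.mp (?_ : (d₃ * s₁ ^ 2 + d₂ * s₂ ^ 2) * t₂ = 0)).resolve_left hQ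
    linear_combination s₂ * q₂ + d₃ * s₁ * q₃

theorem not_isMonoidNet_of_rank_two_of_kernel {S T : Matrix (Fin 4) (Fin 4) ℂ} {d : Fin 4 → ℂ}
    (h0 : d 0 = 0) (h1 : d 1 = 0) (h2 : d 2 ≠ 0) (h3 : d 3 ≠ 0) (hS₀ : S 0 1 = 0) (hS₁ : S 1 1 = 0)
    (hT₀ : T 0 1 = 0) (hT₁ : T 1 1 = 0) : ¬ IsMonoidNet (diagonal d) S T := by
  intro h
  obtain ⟨a, G, ha, -, hdet⟩ := h.exists_det
  have hlin := fun y z => det_diagonal_pencil_linear_coeff (h.isSymm y z) h0 h1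
    (by simp [hS₀, hT₀]) (by simp [hS₁, hT₁]) fun x => hdet x y z
  simp only [Matrix.add_apply, Matrix.smul_apply, smul_eq_mul] at hlin
  obtain ⟨ht₂, ht₃⟩ := eq_zero_of_mul_eq_cube ha h2 h3 hlin
  refine h.det_ne_zero (det_eq_zero_of_row_eq_zero 1 fun j => ?_)
  fin_cases j
  exacts [(h.symm₂.apply 0 1).trans hT₀, hT₁, ht₂, ht₃]

theorem not_isMonoidNet_of_rank_two {S T : Matrix (Fin 4) (Fin 4) ℂ} {d : Fin 4 → ℂ}
    (h0 : d 0 = 0) (h1 : d 1 = 0) (h2 : d 2 ≠ 0) (h3 : d 3 ≠ 0) :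
    ¬ IsMonoidNet (diagonal d) S T := by
  intro h
  obtain ⟨a, G, -, -, hdet⟩ := h.exists_det
  have hquad := fun y z => (mul_eq_zero.mp (det_diagonal_pencil_quadratic_coeff_of_rank_two
    (h.isSymm y z) h0 h1 fun x => hdet x y z)).resolve_right (mul_ne_zero h2 h3)
  simp only [Matrix.add_apply, Matrix.smul_apply, smul_eq_mul] at hquad
  obtain ⟨hss, hst, htt⟩ := binary_quadratic_eq_zero (p := S 0 0 * S 1 1 - S 0 1 ^ 2)
    (q := S 0 0 * T 1 1 + S 1 1 * T 0 0 - 2 * S 0 1 * T 0 1) (r := T 0 0 * T 1 1 - T 0 1 ^ 2)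
    fun y z => by linear_combination hquad y z
  obtain ⟨e₀, e₁, he, hS₀, hS₁, hT₀, hT₁⟩ := exists_common_kernel_of_singular_pencil
    (sub_eq_zero.mp hss) (sub_eq_zero.mp hst) (sub_eq_zero.mp htt)
  have hS₁₀ := h.symm₁.apply 0 1
  have hT₁₀ := h.symm₂.apply 0 1
  obtain ⟨f₀, f₁, hf⟩ : ∃ f₀ f₁ : ℂ, f₀ * e₁ - e₀ * f₁ ≠ 0 := by
    rcases he with he | he
    exacts [⟨0, 1, by simpa using he⟩, ⟨1, 0, by simpa using he⟩]
  -- Column 1 is the common kernel vector and column 0 completes the basis of `ker A`; the diagonal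
  -- form is unchanged since `d 0 = d 1 = 0`.
  let P : Matrix (Fin 4) (Fin 4) ℂ := !![f₀, e₀, 0, 0; f₁, e₁, 0, 0; 0, 0, 1, 0; 0, 0, 0, 1]
  have hP : P.det ≠ 0 := by
    convert hf using 1
    simp [P, det_succ_row_zero, Fin.sum_univ_succ, Fin.succAbove]
    ring
  have hd : Pᵀ * diagonal d * P = diagonal d := by
    ext i j
    fin_cases i <;> fin_cases j <;>
      simp [P, Matrix.mul_apply, Fin.sum_univ_four, diagonal_apply, h0, h1]
  have h' := h.congruence hP
  rw [hd] at h'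
  refine not_isMonoidNet_of_rank_two_of_kernel h0 h1 h2 h3 ?_ ?_ ?_ ?_ h' <;>
    simp [P, Matrix.mul_apply, Fin.sum_univ_four, hS₁₀, hT₁₀]
  · linear_combination f₀ * hS₀ + f₁ * hS₁
  · linear_combination e₀ * hS₀ + e₁ * hS₁
  · linear_combination f₀ * hT₀ + f₁ * hT₁
  · linear_combination e₀ * hT₀ + e₁ * hT₁

/-- A complex symmetric matrix is congruent to a diagonal one whose zero entries come first. -/
theorem Matrix.IsSymm.exists_congruence_diagonal {n : ℕ} {A : Matrix (Fin n) (Fin n) ℂ}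
    (hA : A.IsSymm) : ∃ (P : Matrix (Fin n) (Fin n) ℂ) (d : Fin n → ℂ), P.det ≠ 0 ∧
      Pᵀ * A * P = diagonal d ∧ ∀ i j, i ≤ j → d j = 0 → d i = 0 := by
  classical
  obtain ⟨v', hv'⟩ := LinearMap.BilinForm.exists_orthogonal_basis
    (⟨fun x y => (isSymm_toBilin'_iff_isSymm.mpr hA).eq x y⟩ : LinearMap.IsSymm (toBilin' A))
  obtain ⟨v, hv⟩ : ∃ v : Module.Basis (Fin n) ℂ (Fin n → ℂ),
      ∀ i j, i ≠ j → toBilin' A (v i) (v j) = 0 := by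
    refine ⟨v'.reindex (finCongr (by simp)), fun i j hij => ?_⟩
    simp only [Module.Basis.reindex_apply]
    exact hv' (by simpa using hij)
  -- Sorting by this indicator puts the isotropic basis vectors first.
  let f : Fin n → ℕ := fun i => if toBilin' A (v i) (v i) = 0 then 0 else 1
  let u := v.reindex (Tuple.sort f).symm
  have hu : ∀ i, u i = v (Tuple.sort f i) := fun i => by simp [u]
  let e := Pi.basisFun ℂ (Fin n)
  refine ⟨e.toMatrix u, fun i => toBilin' A (u i) (u i), ?_, ?_, fun i j hij hj => ?_⟩
  · have := e.invertibleToMatrix u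
    exact (isUnit_det_of_invertible _).ne_zero
  · have h := LinearMap.BilinForm.toMatrix_mul_basis_toMatrix e u (toBilin' A)
    have hA' : LinearMap.BilinForm.toMatrix e (toBilin' A) = A := by
      ext i j
      rw [LinearMap.BilinForm.toMatrix_apply, Pi.basisFun_apply, Pi.basisFun_apply]
      exact toBilin'_single A i j
    rw [hA'] at h
    rw [h]
    ext i j
    rw [LinearMap.BilinForm.toMatrix_apply, diagonal_apply]
    split_ifs with hij
    · rw [hij]
    · rw [hu, hu]
      exact hv _ _ (by simpa using hij)
  · have hmono := Tuple.monotone_sort f hij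
    simp only [hu] at hj ⊢
    by_contra hi
    simp [f, hi, hj] at hmono

theorem exists_rank_le_one_of_isMonoidNet {A S T : Matrix (Fin 4) (Fin 4) ℂ} (hA : A.IsSymm)
    (h : IsMonoidNet A S T) : ∃ (P : Matrix (Fin 4) (Fin 4) ℂ) (d : Fin 4 → ℂ), P.det ≠ 0 ∧
      Pᵀ * A * P = diagonal d ∧ d 0 = 0 ∧ d 1 = 0 ∧ d 2 = 0 := by
  obtain ⟨P, d, hP, hd, hmono⟩ := hA.exists_congruence_diagonal
  have h' := h.congruence hP
  rw [hd] at h'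
  have hup : ∀ i j, i ≤ j → d i ≠ 0 → d j ≠ 0 := fun i j hij hi hj => hi (hmono i j hij hj)
  have h0 : d 0 = 0 := by
    by_contra h0
    have := h'.prod_eq_zero
    simp [h0, hup 0 1 (by decide) h0, hup 0 2 (by decide) h0, hup 0 3 (by decide) h0] at this
  have h1 : d 1 = 0 := by
    by_contra h1
    exact not_isMonoidNet_of_rank_three h0 h1 (hup 1 2 (by decide) h1) (hup 1 3 (by decide) h1) h'
  refine ⟨P, d, hP, hd, h0, h1, ?_⟩
  by_contra h2
  exact not_isMonoidNet_of_rank_two h0 h1 h2 (hup 2 3 (by decide) h2) h'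

/-- A symmetric `4 × 4` matrix `A` that spans a net of the above kind has rank at most one, so
that no pencil `x A + R` has a determinant of degree two in `x`. -/
theorem det_pencil_of_isMonoidNet {A R S T : Matrix (Fin 4) (Fin 4) ℂ} (hA : A.IsSymm)
    (h : IsMonoidNet A S T) {c α β : ℂ}
    (hdet : ∀ x : ℂ, (x • A + R).det = c * (x ^ 2 + α * x + β)) : c = 0 := by
  obtain ⟨P, d, hP, hd, h0, h1, h2⟩ := exists_rank_le_one_of_isMonoidNet hA h
  have key : c * P.det ^ 2 = 0 := by
    refine det_diagonal_pencil_rank_le_one (B := Pᵀ * R * P) (α := α) (β := β) h0 h1 h2 fun x => ?_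
    have : x • (Pᵀ * A * P) + Pᵀ * R * P = Pᵀ * (x • A + R) * P := by
      simp only [Matrix.mul_add, Matrix.add_mul, Matrix.mul_smul, Matrix.smul_mul]
    rw [← hd, this, det_mul, det_mul, det_transpose, hdet]
    ring
  simpa [hP] using key

end Net

/-! ### Evaluating the defining polynomials -/

theorem eval_linearMatrix_det {n d : ℕ} (A : Fin (n + 1) → Matrix (Fin d) (Fin d) ℂ)
    (x : Fin (n + 1) → ℂ) : eval x (linearMatrix A).det = (∑ i, x i • A i).det := by
  rw [RingHom.map_det]
  congr 1
  ext i j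
  simp [linearMatrix, Matrix.sum_apply]

theorem eval_changeCoords {n : ℕ} (g : GL (Fin (n + 1)) ℂ) (F : MvPolynomial (Fin (n + 1)) ℂ)
    (x : Fin (n + 1) → ℂ) :
    eval x (changeCoords g F) =
      eval ((g : Matrix (Fin (n + 1)) (Fin (n + 1)) ℂ).mulVec x) F := by
  rw [changeCoords, ← MvPolynomial.coe_aeval_eq_eval, ← MvPolynomial.coe_aeval_eq_eval]
  simp only [RingHom.coe_coe]
  rw [← AlgHom.comp_apply, comp_aeval]
  congr 2
  ext i
  simp [Matrix.mulVec, dotProduct]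

theorem IsSymmetroid.changeCoords {n : ℕ} {F : MvPolynomial (Fin (n + 1)) ℂ} (hF : IsSymmetroid F)
    (g : GL (Fin (n + 1)) ℂ) : IsSymmetroid (changeCoords g F) := by
  obtain ⟨d, A, hA, c, hc, h⟩ := hF
  refine ⟨d, fun j => ∑ i, (g : Matrix (Fin (n + 1)) (Fin (n + 1)) ℂ) i j • A i, fun j => ?_, c, hc,
    MvPolynomial.funext fun x => ?_⟩
  · simp only [Matrix.IsSymm, Matrix.transpose_sum, Matrix.transpose_smul, fun i => (hA i).eq]
  · have h' := congrArg (eval ((g : Matrix (Fin (n + 1)) (Fin (n + 1)) ℂ).mulVec x)) h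
    rw [eval_linearMatrix_det, map_mul, eval_C] at h'
    rw [map_mul, eval_C, eval_changeCoords, h', eval_linearMatrix_det]
    congr 1
    simp only [Matrix.mulVec, dotProduct, Finset.sum_smul, Finset.smul_sum, smul_smul]
    rw [Finset.sum_comm]
    simp only [mul_comm]

theorem MvPolynomial.IsHomogeneous.eval_smul {σ : Type*} {P : MvPolynomial σ ℂ} {n : ℕ}
    (hP : P.IsHomogeneous n) (c : ℂ) (x : σ → ℂ) : eval (c • x) P = c ^ n * eval x P := by
  rw [eval_eq, eval_eq, Finset.mul_sum]
  refine Finset.sum_congr rfl fun m hm => ?_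
  have hdeg : ∑ i ∈ m.support, m i = n := by
    rw [← hP (mem_support_iff.mp hm), Finsupp.weight_apply]
    simp [Finsupp.sum]
  simp only [Pi.smul_apply, smul_eq_mul, mul_pow, Finset.prod_mul_distrib, Finset.prod_pow_eq_pow_sum,
    hdeg]
  ring

theorem eval_zero_left {P : MvPolynomial (Fin 2) ℂ} {n : ℕ} (hP : P.IsHomogeneous n) (y : ℂ) :
    eval ![0, y] P = y ^ n * eval ![0, 1] P := by
  rw [← hP.eval_smul]
  simp

/-- By homogeneity `P(0, x₂) = x₂ⁿ P(0, 1) = 0`, and this substitution does not change the class of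
`P` modulo `X 0`. -/
theorem X_zero_dvd_of_eval_eq_zero {P : MvPolynomial (Fin 2) ℂ} {n : ℕ} (hP : P.IsHomogeneous n)
    (h : eval ![0, 1] P = 0) : X 0 ∣ P := by
  have h0 : aeval ![0, (X 1 : MvPolynomial (Fin 2) ℂ)] P = 0 := by
    refine MvPolynomial.funext fun x => ?_
    have : eval x (aeval ![0, (X 1 : MvPolynomial (Fin 2) ℂ)] P) = eval ![0, x 1] P := by
      rw [← MvPolynomial.coe_aeval_eq_eval, ← MvPolynomial.coe_aeval_eq_eval]
      simp only [RingHom.coe_coe]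
      rw [← AlgHom.comp_apply, comp_aeval]
      congr 2
      ext i
      fin_cases i <;> simp
    rw [this, eval_zero_left hP, h, mul_zero, map_zero]
  rw [← Ideal.mem_span_singleton, ← Ideal.Quotient.eq_zero_iff_mem]
  let I : Ideal (MvPolynomial (Fin 2) ℂ) := Ideal.span {X 0}
  have hcomp : (Ideal.Quotient.mkₐ ℂ I).comp (aeval ![0, (X 1 : MvPolynomial (Fin 2) ℂ)]) =
      Ideal.Quotient.mkₐ ℂ I := by
    refine MvPolynomial.algHom_ext fun i => ?_
    fin_cases i
    · simp only [AlgHom.comp_apply, aeval_X]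
      simpa using (Ideal.Quotient.eq_zero_iff_mem.mpr (Ideal.mem_span_singleton_self (X 0))).symm
    · simp
  have := congrArg (fun f => f P) hcomp
  simp only [AlgHom.comp_apply, h0, map_zero] at this
  exact this.symm

theorem eval_inX1X2 (P : MvPolynomial (Fin 2) ℂ) (x : Fin 4 → ℂ) :
    eval x (inX1X2 P) = eval ![x 1, x 2] P := by
  rw [inX1X2, eval_rename]
  congr 2
  ext i
  fin_cases i <;> rfl

theorem eval_noetherQuartic2 (A₃ B₁ B₂ B₃ B₄ : MvPolynomial (Fin 2) ℂ) (x : Fin 4 → ℂ) :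
    eval x (noetherQuartic2 A₃ B₁ B₂ B₃ B₄) =
      x 1 ^ 2 * x 0 ^ 2 + (x 1 * x 3 * (2 * x 3 + eval ![x 1, x 2] B₁) + eval ![x 1, x 2] A₃) * x 0
        + x 3 ^ 4 + eval ![x 1, x 2] B₁ * x 3 ^ 3 + eval ![x 1, x 2] B₂ * x 3 ^ 2
        + eval ![x 1, x 2] B₃ * x 3 + eval ![x 1, x 2] B₄ := by
  simp [noetherQuartic2, eval_inX1X2]

/-- A symmetric determinantal representation of Noether's quartic has size four. -/
theorem size_eq_four {A₃ B₁ B₂ B₃ B₄ : MvPolynomial (Fin 2) ℂ} (hA₃ : A₃.IsHomogeneous 3)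
    (hB₁ : B₁.IsHomogeneous 1) (hB₂ : B₂.IsHomogeneous 2) (hB₃ : B₃.IsHomogeneous 3)
    (hB₄ : B₄.IsHomogeneous 4) {d : ℕ} {A : Fin 4 → Matrix (Fin d) (Fin d) ℂ} {c : ℂ} (hc : c ≠ 0)
    (h : ∀ x : Fin 4 → ℂ,
      (∑ i, x i • A i).det = c * eval x (noetherQuartic2 A₃ B₁ B₂ B₃ B₄)) : d = 4 := by
  -- At `[0:0:0:t]` only the term `x₃⁴` survives; `t = 1` and `t = 2` then determine `d`.
  have key : ∀ t : ℂ, t ^ d * (A 3).det = c * t ^ 4 := fun t => by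
    have := h ![0, 0, 0, t]
    rw [eval_noetherQuartic2] at this
    simpa [Fin.sum_univ_four, eval_zero_left hA₃ 0, eval_zero_left hB₁ 0, eval_zero_left hB₂ 0,
      eval_zero_left hB₃ 0, eval_zero_left hB₄ 0, Matrix.det_smul] using this
  have h1 : (A 3).det = c := by simpa using key 1
  have h2 := key 2
  rw [h1, mul_comm, mul_right_inj' hc] at h2
  exact Nat.pow_right_injective le_rfl (by exact_mod_cast h2)

theorem not_isSymmetroid_noetherQuartic2 {A₃ B₁ B₂ B₃ B₄ : MvPolynomial (Fin 2) ℂ}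
    (hA₃ : A₃.IsHomogeneous 3) (hB₁ : B₁.IsHomogeneous 1) (hB₂ : B₂.IsHomogeneous 2)
    (hB₃ : B₃.IsHomogeneous 3) (hB₄ : B₄.IsHomogeneous 4) (hdvd : ¬ X 0 ∣ A₃) {c : ℂ}
    (hc : c ≠ 0) : ¬ IsSymmetroid (C c * noetherQuartic2 A₃ B₁ B₂ B₃ B₄) := by
  rintro ⟨d, A, hA, c', hc', h⟩
  have hdet : ∀ x : Fin 4 → ℂ,
      (∑ i, x i • A i).det = c' * c * eval x (noetherQuartic2 A₃ B₁ B₂ B₃ B₄) := fun x => by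
    rw [← eval_linearMatrix_det, ← h]
    simp [mul_assoc]
  have hk : c' * c ≠ 0 := mul_ne_zero hc' hc
  obtain rfl := size_eq_four hA₃ hB₁ hB₂ hB₃ hB₄ hk hdet
  have ha : eval ![0, 1] A₃ ≠ 0 := fun h0 => hdvd (X_zero_dvd_of_eval_eq_zero hA₃ h0)
  -- Section by the plane `x₁ = 0`, the reduced tangent cone at the double point.
  have hnet : IsMonoidNet (A 0) (A 2) (A 3) := by
    refine ⟨hA 2, hA 3, c' * c * eval ![0, 1] A₃,
      fun y z => c' * c * (z ^ 4 + y * eval ![0, 1] B₁ * z ^ 3 + y ^ 2 * eval ![0, 1] B₂ * z ^ 2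
        + y ^ 3 * eval ![0, 1] B₃ * z + y ^ 4 * eval ![0, 1] B₄),
      mul_ne_zero hk ha, by simpa using ⟨hc', hc⟩, fun x y z => ?_⟩
    have := hdet ![x, 0, y, z]
    rw [eval_noetherQuartic2] at this
    simp [Fin.sum_univ_four, eval_zero_left hA₃ y, eval_zero_left hB₁ y, eval_zero_left hB₂ y,
      eval_zero_left hB₃ y, eval_zero_left hB₄ y] at this
    rw [← add_assoc, this]
    ring
  -- Restriction to `x₁ = 1`, `x₂ = x₃ = 0`, where `x₁² x₀²` gives the leading term.
  refine hk (det_pencil_of_isMonoidNet (R := A 1) (α := eval ![1, 0] A₃) (β := eval ![1, 0] B₄)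
    (hA 0) hnet fun x => ?_)
  have := hdet ![x, 1, 0, 0]
  rw [eval_noetherQuartic2] at this
  simp [Fin.sum_univ_four] at this
  rw [this]

theorem mainTheorem4 (F : MvPolynomial (Fin 4) ℂ) (hF : IsNoetherType2 F) :
    ¬ IsSymmetroid F := by
  obtain ⟨g, c, A₃, B₁, B₂, B₃, B₄, hc, hA₃, hB₁, hB₂, hB₃, hB₄, hdvd, hg⟩ := hF
  intro h
  have h' := h.changeCoords g
  rw [hg] at h'
  exact not_isSymmetroid_noetherQuartic2 hA₃ hB₁ hB₂ hB₃ hB₄ hdvd hc h'
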